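/- All graphs are finite, simple and undirected. For a graph $G=(V,E)$, a non-empty set $D\subseteq V$ is a *defensive alliance* if $|N[v]\cap D|\ge |N(v)\setminus D|$ for every $v\in D$; it is a *locally minimal defensive alliance* if moreover $D\setminus\{v\}$ is not a defensive alliance for any $v\in D$. The problem Locally Minimal Defensive Alliance on graphs of minimum degree at least 2 asks, given a (non-empty) graph $G$ of minimum degree at least 2 and an integer $k\ge 0$, whether $G$ has a locally minimal defensive alliance $D$ with $|D|\ge k$. Let $\Delta(G)$ denote the maximum degree of $G$. **Theorem 4.2.** (i) Locally Minimal Defensive Alliance on graphs of minimum degree at least 2 admits a kernel of size $O(\Delta^{k^2+2k})$ when parameterized by the solution size $k$ and the maximum degree $\Delta$. That is, there are a constant $C$ and a map $(G,k)\mapsto (G',k')$ from instances to instances of this problem, computable by a Turing machine in time polynomial in the length of the input (the graph being given by its adjacency matrix and $k$ in unary), such that for every instance $(G,k)$: - $G'$ has a locally minimal defensive alliance of size at least $k'$ if and only if $G$ has one of size at least $k$; - $|V(G')|+|E(G')|$, $k'$ and $\Delta(G')$ are each at most $C\cdot\Delta(G)^{k^2+2k}$. (ii) If $G$ is a connected graph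 of minimum degree at least 2, $k$ is a positive integer, and $\operatorname{diam}(G)\ge 2(k^2+2k)$, then $G$ has a locally minimal defensive alliance of size at least $k$. -/

import Mathlib

namespace LocMinAlliance

section Alliances

variable {V : Type*} [Fintype V] [DecidableEq V] (G : SimpleGraph V) [DecidableRel G.Adj]

/-- A nonempty vertex set `D` is a defensive alliance in `G` if
`|N[v] ∩ D| ≥ |N(v) \ D|` for every `v ∈ D`. -/
def IsDefensiveAlliance (D : Finset V) : Prop :=
  D.Nonempty ∧
    ∀ v ∈ D, (G.neighborFinset v \ D).card ≤ (insert v (G.neighborFinset v) ∩ D).card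

/-- A defensive alliance `D` is locally minimal if `D \ {v}` is not a defensive alliance,
for every `v ∈ D`. -/
def IsLocallyMinimalDefensiveAlliance (D : Finset V) : Prop :=
  IsDefensiveAlliance G D ∧ ∀ v ∈ D, ¬ IsDefensiveAlliance G (D.erase v)

end Alliances

/-- An instance of Locally Minimal Defensive Alliance on graphs of minimum degree at least 2:
a finite simple graph (on the vertex set `{0, …, n - 1}`) of minimum degree at least 2, together
with an integer `k ≥ 0`, the solution size. -/
structure Instance where
  /-- the number of vertices -/
  n : ℕ
  /-- the graph -/
  graph : SimpleGraph (Fin n)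
  /-- the solution size -/
  k : ℕ
  /-- the minimum degree is at least 2 (by the convention of `minDegree`, there is a vertex) -/
  two_le_minDegree : open Classical in 2 ≤ graph.minDegree

namespace Instance

open Classical in
/-- The maximum degree of the graph of an instance. -/
noncomputable def Δ (I : Instance) : ℕ := I.graph.maxDegree

open Classical in
/-- The number of vertices plus the number of edges of the graph of an instance. -/
noncomputable def size (I : Instance) : ℕ := I.n + I.graph.edgeFinset.card

open Classical in
/-- The question: is there a locally minimal defensive alliance with at least `k` vertices? -/
def IsYes (I : Instance) : Prop :=
  ∃ D : Finset (Fin I.n), IsLocallyMinimalDefensiveAlliance I.graph D ∧ I.k ≤ D.card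

open Classical in
/-- The encoding of an instance as a word over the alphabet `{0, 1, #}`, where `some false`,
`some true` and `none` stand for `0`, `1` and `#`: the parameter `k` in unary, then `#`, then the
rows of the adjacency matrix, each of them followed by `#`. -/
noncomputable def encode (I : Instance) : List (Option Bool) :=
  List.replicate I.k (some true) ++ none ::
    (List.finRange I.n).flatMap fun i =>
      (List.finRange I.n).map (fun j => some (decide (I.graph.Adj i j))) ++ [none]

end Instance

/-- `f` is a kernelization of Locally Minimal Defensive Alliance on graphs of minimum degree at
least 2, parameterized by `k` and `Δ`, with size bound `g`: it is computed by a Turing machine in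
polynomial time, it maps each instance to an equivalent one, and the graph and the
parameters of the new instance are bounded by the function `g` of the old parameters. -/
def IsKernelization (f : Instance → Instance) (g : ℕ → ℕ → ℕ) : Prop :=
  Nonempty (Turing.TM2ComputableInPolyTime Instance.encode Instance.encode f) ∧
    ∀ I : Instance,
      ((f I).IsYes ↔ I.IsYes) ∧
        (f I).size ≤ g I.k I.Δ ∧ (f I).k ≤ g I.k I.Δ ∧ (f I).Δ ≤ g I.k I.Δ

end LocMinAlliance

namespace LocMinAlliance

/-! ### Tight vertices and local minimality. -/

section Graph

open Finset

variable {V : Type*} [Fintype V] [DecidableEq V] {G : SimpleGraph V} [DecidableRel G.Adj]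

/-! Call a vertex of an alliance tight if it cannot lose a neighbor inside. In minimum degree 2, an
alliance is locally minimal exactly when each of its vertices has a tight neighbor in it. This
condition is local, so locally minimal alliances with no edge between them have a locally minimal
union.

Diameter: if no locally minimal alliance has `k` vertices, every ball of radius `k` contains one
(`exists_isLocallyMinimal_large_or_near`). Centers whose distances from one end of a diameter are
multiples of `2 * k + 2` give `k` balls with no edges between them, and the union of their alliances
has at least `k` vertices.

Kernel: if all locally minimal alliances are smaller than `k`, their vertices have degree at most `2
* k`. The low-degree closed neighborhood `F` of a maximal one then meets every alliance, and peeling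
vertices off the complement of `F` bounds its size by the cut around `F`
(`card_le_of_forall_card_lt`). This vertex bound is polynomial in `k` and free of `Δ`, so every
instance above a threshold `2 ^ (k + 15)` is a yes-instance and may become a triangle. A Turing
machine tests the threshold by repeated halving, and `Δ ≥ 2` hides the threshold in the claimed
bound. -/

/-- A nonempty set is a defensive alliance if and only if each of its vertices has at least
`⌊deg v / 2⌋` neighbors in it. -/
theorem isDefensiveAlliance_iff {D : Finset V} :
    IsDefensiveAlliance G D ↔
      D.Nonempty ∧ ∀ v ∈ D, G.degree v ≤ 2 * (G.neighborFinset v ∩ D).card + 1 := by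
  refine and_congr_right fun _ => forall₂_congr fun v hv => ?_
  rw [insert_inter_of_mem hv, card_insert_of_notMem (by simp),
    ← G.card_neighborFinset_eq_degree, ← card_inter_add_card_sdiff (G.neighborFinset v) D]
  omega

theorem isDefensiveAlliance_univ [Nonempty V] : IsDefensiveAlliance G (univ : Finset V) := by
  refine isDefensiveAlliance_iff.2 ⟨univ_nonempty, fun v _ => ?_⟩
  simp only [inter_univ, G.card_neighborFinset_eq_degree]
  omega

/-- In minimum degree at least 2, a defensive alliance stops being one when `v` is removed if and
only if `v` has a neighbor in it all of whose neighbors inside the alliance are needed. -/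
theorem not_isDefensiveAlliance_erase_iff (hG : ∀ v, 2 ≤ G.degree v) {D : Finset V}
    (hD : IsDefensiveAlliance G D) {v : V} (hv : v ∈ D) :
    ¬ IsDefensiveAlliance G (D.erase v) ↔
      ∃ u ∈ D, G.Adj v u ∧ 2 * (G.neighborFinset u ∩ D).card ≤ G.degree u := by
  rw [isDefensiveAlliance_iff] at hD
  have key : ∀ u, G.Adj v u →
      (G.neighborFinset u ∩ D.erase v).card + 1 = (G.neighborFinset u ∩ D).card := by
    intro u hu
    rw [inter_erase, card_erase_add_one]
    simp [hv, hu.symm]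
  have key' : ∀ u, ¬ G.Adj v u → G.neighborFinset u ∩ D.erase v = G.neighborFinset u ∩ D := by
    intro u hu
    rw [inter_erase, erase_eq_of_notMem]
    simp only [mem_inter, SimpleGraph.mem_neighborFinset, not_and]
    exact fun h => absurd h.symm hu
  -- Degree at least 2 forces a neighbor of `v` inside `D`, so nonemptiness never blocks a removal.
  have hne : (D.erase v).Nonempty := by
    have h1 := hD.2 v hv
    have h2 := hG v
    obtain ⟨w, hw⟩ : (G.neighborFinset v ∩ D).Nonempty := card_pos.1 (by omega)
    simp only [mem_inter, SimpleGraph.mem_neighborFinset] at hw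
    exact ⟨w, mem_erase.2 ⟨hw.1.ne', hw.2⟩⟩
  rw [isDefensiveAlliance_iff, not_and]
  constructor
  · intro h
    have h' := h hne
    push Not at h'
    obtain ⟨u, hu, hlt⟩ := h'
    have huD := mem_of_mem_erase hu
    have h1 := hD.2 u huD
    by_cases ha : G.Adj v u
    · exact ⟨u, huD, ha, by have := key u ha; omega⟩
    · rw [key' u ha] at hlt
      omega
  · rintro ⟨u, hu, ha, ht⟩ - h
    have := h u (mem_erase.2 ⟨ha.ne', hu⟩)
    have := key u ha
    omega

theorem isLocallyMinimalDefensiveAlliance_iff (hG : ∀ v, 2 ≤ G.degree v) {D : Finset V} :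
    IsLocallyMinimalDefensiveAlliance G D ↔ IsDefensiveAlliance G D ∧
      ∀ v ∈ D, ∃ u ∈ D, G.Adj v u ∧ 2 * (G.neighborFinset u ∩ D).card ≤ G.degree u :=
  and_congr_right fun hD => forall₂_congr fun _ hv => not_isDefensiveAlliance_erase_iff hG hD hv

/-- Every defensive alliance contains a locally minimal one. -/
theorem IsDefensiveAlliance.exists_isLocallyMinimal {D : Finset V}
    (hD : IsDefensiveAlliance G D) :
    ∃ S ⊆ D, IsLocallyMinimalDefensiveAlliance G S := by
  obtain ⟨S, hSD, hS, hmin⟩ := exists_minimal_le_of_wellFoundedLT (IsDefensiveAlliance G) D hD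
  exact ⟨S, hSD, hS, fun v hv h => notMem_erase v S (hmin h (erase_subset _ _) hv)⟩

/-- The union of two locally minimal defensive alliances at distance at least 2 is locally
minimal. -/
theorem IsLocallyMinimalDefensiveAlliance.union (hG : ∀ v, 2 ≤ G.degree v) {S T : Finset V}
    (hS : IsLocallyMinimalDefensiveAlliance G S) (hT : IsLocallyMinimalDefensiveAlliance G T)
    (hST : ∀ u ∈ S, ∀ w ∈ T, ¬ G.Adj u w) :
    IsLocallyMinimalDefensiveAlliance G (S ∪ T) := by
  have hl : ∀ u ∈ S, G.neighborFinset u ∩ (S ∪ T) = G.neighborFinset u ∩ S := by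
    intro u hu
    ext w
    simp only [mem_inter, mem_union, SimpleGraph.mem_neighborFinset]
    exact ⟨fun h => ⟨h.1, h.2.resolve_right fun hw => hST u hu w hw h.1⟩,
      fun h => ⟨h.1, Or.inl h.2⟩⟩
  have hr : ∀ u ∈ T, G.neighborFinset u ∩ (S ∪ T) = G.neighborFinset u ∩ T := by
    intro u hu
    ext w
    simp only [mem_inter, mem_union, SimpleGraph.mem_neighborFinset]
    exact ⟨fun h => ⟨h.1, h.2.resolve_left fun hw => hST w hw u hu h.1.symm⟩,
      fun h => ⟨h.1, Or.inr h.2⟩⟩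
  rw [isLocallyMinimalDefensiveAlliance_iff hG, isDefensiveAlliance_iff] at *
  refine ⟨⟨hS.1.1.mono subset_union_left, fun v hv => ?_⟩, fun v hv => ?_⟩
  · rcases mem_union.1 hv with h | h
    · rw [hl v h]; exact hS.1.2 v h
    · rw [hr v h]; exact hT.1.2 v h
  · rcases mem_union.1 hv with h | h
    · obtain ⟨u, hu, ha, ht⟩ := hS.2 v h
      exact ⟨u, mem_union_left _ hu, ha, by rwa [hl u hu]⟩
    · obtain ⟨u, hu, ha, ht⟩ := hT.2 v h
      exact ⟨u, mem_union_right _ hu, ha, by rwa [hr u hu]⟩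

/-! ### Alliances near a vertex, and large diameter. -/

/-- A minimal defensive alliance containing `v` contains a locally minimal one from which only
`v` and neighbors of `v` are missing. -/
theorem exists_isLocallyMinimal_of_minimal (hG : ∀ v, 2 ≤ G.degree v) {D : Finset V} {v : V}
    (hD : Minimal (fun D => IsDefensiveAlliance G D ∧ v ∈ D) D) :
    ∃ S ⊆ D, IsLocallyMinimalDefensiveAlliance G S ∧
      ∀ u ∈ D, u ≠ v → ¬ G.Adj v u → u ∈ S := by
  obtain ⟨⟨hDa, hvD⟩, hmin⟩ := hD
  have htight : ∀ u ∈ D, u ≠ v → ∃ t ∈ D, G.Adj u t ∧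
      2 * (G.neighborFinset t ∩ D).card ≤ G.degree t := by
    intro u hu huv
    rw [← not_isDefensiveAlliance_erase_iff hG hDa hu]
    intro h
    exact notMem_erase u D (hmin ⟨h, mem_erase.2 ⟨huv.symm, hvD⟩⟩ (erase_subset _ _) hu)
  -- Only `v` can lack a tight neighbor. If it does, shrink `D` as far as possible while keeping
  -- everything outside the closed neighborhood of `v`.
  by_cases hv : ∃ t ∈ D, G.Adj v t ∧ 2 * (G.neighborFinset t ∩ D).card ≤ G.degree t
  · refine ⟨D, subset_rfl, (isLocallyMinimalDefensiveAlliance_iff hG).2 ⟨hDa, fun u hu => ?_⟩,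
      fun u hu _ _ => hu⟩
    rcases eq_or_ne u v with rfl | huv
    exacts [hv, htight u hu huv]
  · obtain ⟨S, hSD, ⟨hSa, hSc⟩, hSmin⟩ := exists_minimal_le_of_wellFoundedLT
      (fun S => IsDefensiveAlliance G S ∧ ∀ u ∈ D, u ≠ v → ¬ G.Adj v u → u ∈ S) D
      ⟨hDa, fun u hu _ _ => hu⟩
    refine ⟨S, hSD, (isLocallyMinimalDefensiveAlliance_iff hG).2 ⟨hSa, fun u hu => ?_⟩, hSc⟩
    have hsub : ∀ t, G.neighborFinset t ∩ S ⊆ G.neighborFinset t ∩ D :=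
      fun t => inter_subset_inter_left hSD
    by_cases hu' : u ≠ v ∧ ¬ G.Adj v u
    -- The tight `t` is neither `v` nor a neighbor of `v`, so it survives in `S`, and it stays tight
    -- in the smaller set.
    · obtain ⟨t, htD, hut, ht⟩ := htight u (hSD hu) hu'.1
      have htv : t ≠ v := by
        rintro rfl
        exact hu'.2 hut.symm
      have hvt : ¬ G.Adj v t := fun h => hv ⟨t, htD, h, ht⟩
      exact ⟨t, hSc t htD htv hvt, hut,
        le_trans (Nat.mul_le_mul_left 2 (card_le_card (hsub t))) ht⟩
    · rw [← not_isDefensiveAlliance_erase_iff hG hSa hu]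
      intro h
      refine notMem_erase u S (hSmin ⟨h, fun w hw hwv hvw => mem_erase.2 ⟨?_, hSc w hw hwv hvw⟩⟩
        (erase_subset _ _) hu)
      rintro rfl
      exact hu' ⟨hwv, hvw⟩

/-- Every ball of radius `k` contains a locally minimal defensive alliance, unless there is one
with at least `k` vertices. -/
theorem exists_isLocallyMinimal_large_or_near (hG : ∀ v, 2 ≤ G.degree v) (hc : G.Connected)
    (v : V) (k : ℕ) :
    ∃ S, IsLocallyMinimalDefensiveAlliance G S ∧ (k ≤ S.card ∨ ∀ u ∈ S, G.dist v u ≤ k) := by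
  have : Nonempty V := ⟨v⟩
  obtain ⟨D, -, hD⟩ := exists_minimal_le_of_wellFoundedLT
    (fun D => IsDefensiveAlliance G D ∧ v ∈ D) univ
    ⟨isDefensiveAlliance_univ, mem_univ v⟩
  obtain ⟨S, hSD, hS, hDS⟩ := exists_isLocallyMinimal_of_minimal hG hD
  refine ⟨S, hS, ?_⟩
  -- Layers start at 2 because `S` may miss `v` and its neighbors. If all `k` layers are met, `S` is
  -- large. An empty layer `i` cuts off the part of `D` below it as an alliance containing `v`, so
  -- by minimality `D` lies within distance `i - 1 ≤ k`.
  by_cases hl : ∀ i ∈ Icc 2 (k + 1), ∃ u ∈ D, G.dist v u = i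
  · left
    have hsub : Icc 2 (k + 1) ⊆ S.image (G.dist v) := by
      intro i hi
      obtain ⟨u, hu, rfl⟩ := hl i hi
      have h2 := (mem_Icc.1 hi).1
      refine mem_image_of_mem _ (hDS u hu ?_ fun h => ?_)
      · rintro rfl
        simp at h2
      · rw [SimpleGraph.dist_eq_one_iff_adj.2 h] at h2
        omega
    simpa using (card_le_card hsub).trans card_image_le
  · right
    push Not at hl
    obtain ⟨i, hi, hiD⟩ := hl
    rw [mem_Icc] at hi
    have hv : v ∈ D.filter fun u => G.dist v u < i := by
      simp only [mem_filter, SimpleGraph.dist_self]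
      exact ⟨hD.1.2, by omega⟩
    have hall : IsDefensiveAlliance G (D.filter fun u => G.dist v u < i) := by
      refine isDefensiveAlliance_iff.2 ⟨⟨v, hv⟩, fun u hu => ?_⟩
      rw [mem_filter] at hu
      have hsub : G.neighborFinset u ∩ D ⊆
          G.neighborFinset u ∩ D.filter fun u => G.dist v u < i := by
        intro w hw
        simp only [mem_inter, SimpleGraph.mem_neighborFinset, mem_filter] at hw ⊢
        refine ⟨hw.1, hw.2, lt_of_le_of_ne ?_ (hiD w hw.2)⟩
        have := hc.dist_triangle (u := v) (v := u) (w := w)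
        rw [SimpleGraph.dist_eq_one_iff_adj.2 hw.1] at this
        omega
      have := (isDefensiveAlliance_iff.1 hD.1.1).2 u hu.1
      have := card_le_card hsub
      omega
    intro u hu
    have := (mem_filter.1 (hD.2 ⟨hall, hv⟩ (filter_subset _ _) (hSD hu))).2
    omega

theorem exists_dist_eq_of_le_dist {W : Type*} {H : SimpleGraph W} (hc : H.Connected) {a b : W}
    {i : ℕ} (hi : i ≤ H.dist a b) : ∃ x, H.dist a x = i := by
  obtain ⟨p, hp⟩ := hc.exists_walk_length_eq_dist a b
  refine ⟨p.getVert i, le_antisymm ?_ ?_⟩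
  · refine (SimpleGraph.dist_le (p.take i)).trans ?_
    simp
  · have h1 := SimpleGraph.dist_le (p.drop i)
    have h2 := hc.dist_triangle (u := a) (v := p.getVert i) (w := b)
    rw [SimpleGraph.Walk.drop_length] at h1
    omega

/-- In a connected graph of minimum degree at least 2 and diameter at least `2 * (k ^ 2 + 2 * k)`
there is a locally minimal defensive alliance with at least `k` vertices. -/
theorem exists_isLocallyMinimal_of_le_diam (hG : ∀ v, 2 ≤ G.degree v) (hc : G.Connected) {k : ℕ}
    (hk : 0 < k) (hd : 2 * (k ^ 2 + 2 * k) ≤ G.diam) :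
    ∃ D, IsLocallyMinimalDefensiveAlliance G D ∧ k ≤ D.card := by
  by_contra! hsmall
  have hball : ∀ v, ∃ S, IsLocallyMinimalDefensiveAlliance G S ∧ ∀ u ∈ S, G.dist v u ≤ k := by
    intro v
    obtain ⟨S, hS, h | h⟩ := exists_isLocallyMinimal_large_or_near hG hc v k
    exacts [absurd h (hsmall S hS).not_ge, ⟨S, hS, h⟩]
  have := hc.nonempty
  obtain ⟨a, b, hab⟩ := G.exists_dist_eq_diam
  have hchain : ∀ m < k, ∃ S, IsLocallyMinimalDefensiveAlliance G S ∧ m < S.card ∧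
      ∀ u ∈ S, G.dist a u ≤ m * (2 * k + 2) + k := by
    intro m
    induction m with
    | zero =>
      intro _
      obtain ⟨S, hS, h⟩ := hball a
      exact ⟨S, hS, card_pos.2 hS.1.1, by simpa using h⟩
    | succ m ih =>
      intro hm
      obtain ⟨S, hS, hcard, hSd⟩ := ih (by omega)
      -- Distances from `a` alone separate the balls: `(m + 1) * (2 * k + 2) - k` exceeds `m * (2 *
      -- k + 2) + k` by 2. The last center is at distance `2 * k ^ 2 - 2`, within the diameter.
      obtain ⟨x, hx⟩ := exists_dist_eq_of_le_dist (a := a) (b := b)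
        (i := (m + 1) * (2 * k + 2)) hc (by rw [hab]; nlinarith)
      obtain ⟨T, hT, hTd⟩ := hball x
      have hlow : ∀ w ∈ T, (m + 1) * (2 * k + 2) ≤ G.dist a w + k := by
        intro w hw
        have h1 := hTd w hw
        have h2 := hc.dist_triangle (u := a) (v := w) (w := x)
        rw [G.dist_comm (u := w)] at h2
        omega
      have hexp : (m + 1) * (2 * k + 2) = m * (2 * k + 2) + 2 * k + 2 := by ring
      refine ⟨S ∪ T, hS.union hG hT fun u hu w hw huw => ?_, ?_, fun u hu => ?_⟩
      · have h1 := hSd u hu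
        have h2 := hlow w hw
        have h3 := hc.dist_triangle (u := a) (v := u) (w := w)
        rw [SimpleGraph.dist_eq_one_iff_adj.2 huw] at h3
        omega
      · have hdisj : Disjoint S T := by
          rw [disjoint_left]
          intro u hu hu'
          have h1 := hSd u hu
          have h2 := hlow u hu'
          omega
        have := card_pos.2 hT.1.1
        rw [card_union_of_disjoint hdisj]
        omega
      · rcases mem_union.1 hu with h | h
        · have := hSd u h
          omega
        · have h1 := hTd u h
          have h2 := hc.dist_triangle (u := a) (v := x) (w := u)
          omega
  obtain ⟨S, hS, hcard, -⟩ := hchain (k - 1) (by omega)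
  have := hsmall S hS
  omega

/-! ### The vertex bound for no-instances. -/

/-- If no defensive alliance avoids `F`, then the vertices outside `F` are at most as many as the
edges leaving `F`. -/
theorem card_compl_le_of_forall_not_isDefensiveAlliance (F : Finset V)
    (hF : ∀ D, Disjoint F D → ¬ IsDefensiveAlliance G D) :
    Fᶜ.card ≤ ∑ v ∈ F, (G.neighborFinset v \ F).card := by
  induction hn : Fᶜ.card generalizing F with
  | zero => exact Nat.zero_le _
  | succ n ih =>
    have hne : Fᶜ.Nonempty := card_pos.1 (by omega)
    -- Since `Fᶜ` is not an alliance, some `v` in it has more neighbors in `F` than outside. Moving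
    -- `v` into `F` shrinks the cut by at least 1, which pays for `v`.
    have h := hF Fᶜ disjoint_compl_right
    rw [isDefensiveAlliance_iff] at h
    push Not at h
    obtain ⟨v, hv, hlt⟩ := h hne
    have hvF := mem_compl.1 hv
    have hcard : (insert v F)ᶜ.card = n := by
      rw [compl_insert, card_erase_of_mem hv]
      omega
    have ih' := ih (insert v F) (fun D hD => hF D (hD.mono_left (subset_insert _ _))) hcard
    rw [sum_insert hvF] at ih'
    have h1 : (G.neighborFinset v \ insert v F).card ≤ (G.neighborFinset v ∩ Fᶜ).card := by
      refine card_le_card fun w hw => ?_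
      simp only [mem_sdiff, mem_insert, not_or, mem_inter, mem_compl] at hw ⊢
      exact ⟨hw.1, hw.2.2⟩
    have h2 : ∑ w ∈ F, (G.neighborFinset w \ insert v F).card + (G.neighborFinset v ∩ F).card =
        ∑ w ∈ F, (G.neighborFinset w \ F).card := by
      rw [inter_comm, ← filter_mem_eq_inter, card_filter, ← sum_add_distrib]
      refine sum_congr rfl fun w hw => ?_
      rw [sdiff_insert]
      by_cases hvw : G.Adj v w
      · rw [if_pos (by simpa using hvw), card_erase_add_one]
        simp [hvw.symm, hvF]
      · rw [if_neg (by simpa using hvw), erase_eq_of_notMem, add_zero]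
        simp only [mem_sdiff, SimpleGraph.mem_neighborFinset, not_and]
        exact fun h => absurd h.symm hvw
    have h3 : (G.neighborFinset v ∩ F).card + (G.neighborFinset v ∩ Fᶜ).card = G.degree v := by
      rw [← G.card_neighborFinset_eq_degree, ← card_inter_add_card_sdiff (G.neighborFinset v) F,
        sdiff_eq_inter_compl]
    omega

/-- If all locally minimal defensive alliances have fewer than `k` vertices, then the graph has
at most `k * (2 * k + 1) ^ 2` vertices. -/
theorem card_le_of_forall_card_lt (hG : ∀ v, 2 ≤ G.degree v) {k : ℕ}
    (hk : ∀ S, IsLocallyMinimalDefensiveAlliance G S → S.card < k) :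
    Fintype.card V ≤ k * (2 * k + 1) ^ 2 := by
  rcases isEmpty_or_nonempty V with hV | hV
  · simp
  have hdeg : ∀ S, IsLocallyMinimalDefensiveAlliance G S → ∀ v ∈ S, G.degree v ≤ 2 * k := by
    intro S hS v hv
    have h1 := (isDefensiveAlliance_iff.1 hS.1).2 v hv
    have h2 : (G.neighborFinset v ∩ S).card ≤ S.card := card_le_card inter_subset_right
    have h3 := hk S hS
    omega
  obtain ⟨S₀, -, hS₀⟩ := (isDefensiveAlliance_univ (G := G)).exists_isLocallyMinimal
  obtain ⟨S, hS, hmax⟩ := (Set.toFinite {S | IsLocallyMinimalDefensiveAlliance G S}).exists_maximal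
    ⟨S₀, hS₀⟩
  rw [Set.mem_ofPred_eq] at hS
  -- Dropping high degrees keeps the cut bounded in `k`, and loses nothing, since no locally minimal
  -- alliance contains such a vertex. An alliance avoiding `F` would contain a locally minimal `T`
  -- without edges to `S`, against the maximality of `S`.
  set F := (S.biUnion fun v => insert v (G.neighborFinset v)).filter fun v => G.degree v ≤ 2 * k
    with hFdef
  have hF : ∀ D, Disjoint F D → ¬ IsDefensiveAlliance G D := by
    intro D hFD hD
    obtain ⟨T, hTD, hT⟩ := hD.exists_isLocallyMinimal
    have hout : ∀ u ∈ S, ∀ w ∈ T, w ∉ insert u (G.neighborFinset u) := fun u hu w hw h =>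
      disjoint_left.1 hFD
        (mem_filter.2 ⟨mem_biUnion.2 ⟨u, hu, h⟩, hdeg T hT w hw⟩) (hTD hw)
    have hU := hS.union hG hT fun u hu w hw h => hout u hu w hw (by simp [h])
    obtain ⟨w, hw⟩ := hT.1.1
    have hwS : w ∈ S := hmax hU subset_union_left (mem_union_right _ hw)
    exact hout w hwS w hw (mem_insert_self _ _)
  have hFcard : F.card ≤ k * (2 * k + 1) := by
    refine (card_filter_le _ _).trans (card_biUnion_le.trans ?_)
    refine (sum_le_card_nsmul S _ (2 * k + 1) fun v hv => ?_).trans ?_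
    · refine (card_insert_le _ _).trans ?_
      rw [G.card_neighborFinset_eq_degree]
      have := hdeg S hS v hv
      omega
    · exact Nat.mul_le_mul_right _ (hk S hS).le
  have hcut : ∑ v ∈ F, (G.neighborFinset v \ F).card ≤ F.card * (2 * k) := by
    refine sum_le_card_nsmul F _ (2 * k) fun v hv => ?_
    refine (card_le_card sdiff_subset).trans ?_
    rw [G.card_neighborFinset_eq_degree]
    exact (mem_filter.1 hv).2
  calc Fintype.card V = F.card + Fᶜ.card := (card_add_card_compl F).symm
    _ ≤ F.card + F.card * (2 * k) :=
      Nat.add_le_add_left ((card_compl_le_of_forall_not_isDefensiveAlliance F hF).trans hcut) _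
    _ = F.card * (2 * k + 1) := by ring
    _ ≤ k * (2 * k + 1) * (2 * k + 1) := Nat.mul_le_mul_right _ hFcard
    _ = k * (2 * k + 1) ^ 2 := by ring

end Graph

/-! ### The Turing machine comparing a length with a power of two. -/

section Machine

open Turing StateTransition

/-- The stacks of the kernelization machine. -/
inductive Stack
  | input | output | copy | counter | len | half
  deriving DecidableEq

instance : Fintype Stack :=
  ⟨{.input, .output, .copy, .counter, .len, .half}, fun s => by cases s <;> simp⟩

/-- The labels of the kernelization machine. -/
inductive Label
  | readParam | readBody | count | halve | restore | test | emit | clearLen | clearCopy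
  deriving DecidableEq

instance : Fintype Label :=
  ⟨{.readParam, .readBody, .count, .halve, .restore, .test, .emit, .clearLen, .clearCopy},
    fun l => by cases l <;> simp⟩

/-- The common alphabet of all stacks. -/
abbrev Letter := Option Bool

/-- The symbols of `w` are pushed on the output stack, so that the last one ends up on top. -/
def pushWord (w : List Letter) (q : TM2.Stmt (fun _ : Stack => Letter) Label (Option Letter)) :
    TM2.Stmt (fun _ : Stack => Letter) Label (Option Letter) :=
  w.foldr (fun a q => .push .output (fun _ => a) q) q

/-- Pushes `m` tally marks on the counter stack. -/
def pushTally (m : ℕ) (q : TM2.Stmt (fun _ : Stack => Letter) Label (Option Letter)) :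
    TM2.Stmt (fun _ : Stack => Letter) Label (Option Letter) :=
  (fun q => .push .counter (fun _ => some true) q)^[m] q

/-- Pops a stack into the internal state, and branches on whether it was nonempty. -/
def popCases (s : Stack) (q₁ q₂ : TM2.Stmt (fun _ : Stack => Letter) Label (Option Letter)) :
    TM2.Stmt (fun _ : Stack => Letter) Label (Option Letter) :=
  .pop s (fun _ a => a) (.branch Option.isSome q₁ q₂)

/-- On the input `1ᵏ # v`, the machine halves the length of `v` a total of `k + c` times. If
something is left it outputs the reverse of `w`, and otherwise it outputs its input. -/
def program (c : ℕ) (w : List Letter) :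
    Label → TM2.Stmt (fun _ : Stack => Letter) Label (Option Letter)
  | .readParam =>
      -- The default of `getD` matters only on an empty stack, which is not reached here on an
      -- encoded instance.
      .pop .input (fun _ a => a) <| .push .copy (fun a => a.getD none) <|
        .branch (fun a => a == some (some true))
          (.push .counter (fun _ => some true) (.goto fun _ => .readParam))
          (pushTally c (.goto fun _ => .readBody))
  | .readBody =>
      popCases .input
        (.push .copy (fun a => a.getD none) <| .push .len (fun _ => some true) <|
          .goto fun _ => .readBody)
        (.goto fun _ => .count)
  | .count => popCases .counter (.goto fun _ => .halve) (.goto fun _ => .test)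
  | .halve =>
      -- Two marks are traded for one; an odd last mark is discarded, which rounds down.
      popCases .len
        (popCases .len
          (.push .half (fun _ => some true) (.goto fun _ => .halve))
          (.goto fun _ => .restore))
        (.goto fun _ => .restore)
  | .restore =>
      popCases .half (.push .len (fun _ => some true) (.goto fun _ => .restore))
        (.goto fun _ => .count)
  | .test => popCases .len (.goto fun _ => .clearLen) (.goto fun _ => .emit)
  | .emit =>
      popCases .copy (.push .output (fun a => a.getD none) (.goto fun _ => .emit)) .halt
  | .clearLen => popCases .len (.goto fun _ => .clearLen) (.goto fun _ => .clearCopy)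
  | .clearCopy => popCases .copy (.goto fun _ => .clearCopy) (pushWord w .halt)

/-- The kernelization machine. -/
def machine (c : ℕ) (w : List Letter) : FinTM2 where
  K := Stack
  k₀ := .input
  k₁ := .output
  Γ _ := Letter
  Λ := Label
  main := .readParam
  σ := Option Letter
  initialState := none
  m := program c w

/-- The contents of the stacks, of which three hold unary numbers. -/
def store (i o t : List Letter) (k a b : ℕ) : Stack → List Letter
  | .input => i
  | .output => o
  | .copy => t
  | .counter => List.replicate k (some true)
  | .len => List.replicate a (some true)
  | .half => List.replicate b (some true)

section Update

variable (i o t l : List Letter) (k a b m : ℕ)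

@[simp] theorem update_input :
    Function.update (store i o t k a b) .input l = store l o t k a b := by
  funext s; cases s <;> rfl

@[simp] theorem update_output :
    Function.update (store i o t k a b) .output l = store i l t k a b := by
  funext s; cases s <;> rfl

@[simp] theorem update_copy :
    Function.update (store i o t k a b) .copy l = store i o l k a b := by
  funext s; cases s <;> rfl

@[simp] theorem update_counter :
    Function.update (store i o t k a b) .counter (List.replicate m (some true)) =
      store i o t m a b := by
  funext s; cases s <;> rfl

@[simp] theorem update_len :
    Function.update (store i o t k a b) .len (List.replicate m (some true)) =
      store i o t k m b := by
  funext s; cases s <;> rfl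

@[simp] theorem update_len_nil :
    Function.update (store i o t k a b) .len [] = store i o t k 0 b :=
  update_len i o t k a b 0

@[simp] theorem update_half :
    Function.update (store i o t k a b) .half (List.replicate m (some true)) =
      store i o t k a m := by
  funext s; cases s <;> rfl

@[simp] theorem store_input : store i o t k a b .input = i := rfl
@[simp] theorem store_output : store i o t k a b .output = o := rfl
@[simp] theorem store_copy : store i o t k a b .copy = t := rfl
@[simp] theorem store_counter :
    store i o t k a b .counter = List.replicate k (some true) := rfl
@[simp] theorem store_len : store i o t k a b .len = List.replicate a (some true) := rfl
@[simp] theorem store_half : store i o t k a b .half = List.replicate b (some true) := rfl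

end Update

/-- The configurations of the kernelization machine. -/
abbrev Config := TM2.Cfg (fun _ : Stack => Letter) Label (Option Letter)

/-- `M` gets from `x` to `y` in at most `n` steps. -/
def RunsIn (M : Label → TM2.Stmt (fun _ : Stack => Letter) Label (Option Letter))
    (x y : Config) (n : ℕ) : Prop :=
  Nonempty (EvalsToInTime (TM2.step M) x (some y) n)

section Runs

variable {M : Label → TM2.Stmt (fun _ : Stack => Letter) Label (Option Letter)}

theorem RunsIn.trans {x y z : Config} {m n : ℕ} (h₁ : RunsIn M x y m) (h₂ : RunsIn M y z n) :
    RunsIn M x z (m + n) := by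
  obtain ⟨h₁⟩ := h₁
  obtain ⟨h₂⟩ := h₂
  exact ⟨Nat.add_comm n m ▸ EvalsToInTime.trans _ _ _ _ _ _ h₁ h₂⟩

theorem RunsIn.mono {x y : Config} {m n : ℕ} (h : RunsIn M x y m) (hmn : m ≤ n) :
    RunsIn M x y n := by
  obtain ⟨h⟩ := h
  exact ⟨⟨h.toEvalsTo, h.steps_le_m.trans hmn⟩⟩

theorem RunsIn.step {x y : Config} (h : TM2.step M x = some y) : RunsIn M x y 1 :=
  ⟨⟨⟨1, h⟩, le_rfl⟩⟩

theorem RunsIn.head {x y z : Config} {n : ℕ} (h : TM2.step M x = some y) (h' : RunsIn M y z n) :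
    RunsIn M x z (n + 1) :=
  ((RunsIn.step h).trans h').mono (by omega)

end Runs

/-! ### Correctness and running time of each phase. -/

section Program

variable {c : ℕ} {w : List Letter}

theorem stepAux_pushWord (v : Option Letter) (i o t : List Letter) (k a b : ℕ) :
    TM2.stepAux (pushWord w .halt) v (store i o t k a b) =
      ⟨none, v, store i (w.reverse ++ o) t k a b⟩ := by
  induction w generalizing o with
  | nil => rfl
  | cons x w ih =>
    have := ih (x :: o)
    simpa [pushWord] using this

theorem stepAux_pushTally (q : TM2.Stmt (fun _ : Stack => Letter) Label (Option Letter))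
    (v : Option Letter) (i o t : List Letter) (k a b : ℕ) :
    TM2.stepAux (pushTally c q) v (store i o t k a b) =
      TM2.stepAux q v (store i o t (k + c) a b) := by
  induction c generalizing k with
  | zero => rfl
  | succ c ih =>
    have := ih (k + 1)
    rw [pushTally, Function.iterate_succ_apply']
    simp only [TM2.stepAux, store_counter, ← List.replicate_succ, update_counter]
    rw [show k + (c + 1) = k + 1 + c by omega]
    exact this

theorem run_readParam (i t : List Letter) (v : Option Letter) (m k : ℕ) :
    RunsIn (program c w)
      ⟨some .readParam, v, store (List.replicate m (some true) ++ none :: i) [] t k 0 0⟩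
      ⟨some .readBody, some none,
        store i [] (none :: (List.replicate m (some true) ++ t)) (k + m + c) 0 0⟩ (m + 1) := by
  induction m generalizing v t k with
  | zero =>
    refine RunsIn.step ?_
    simp [program, stepAux_pushTally]
  | succ m ih =>
    have := ih (some true :: t) (some (some true)) (k + 1)
    refine RunsIn.head (y := ⟨some .readParam, some (some true),
      store (List.replicate m (some true) ++ none :: i) [] (some true :: t) (k + 1) 0 0⟩) ?_ ?_
    · simp [program, List.replicate_succ, ← update_counter (k := k) (m := k + 1)]
    · rw [List.append_cons _ (some true) t, ← List.replicate_succ', show k + 1 + m = k + (m + 1) by omega] at this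
      exact this

theorem run_readBody (i t : List Letter) (v : Option Letter) (k a : ℕ) :
    RunsIn (program c w) ⟨some .readBody, v, store i [] t k a 0⟩
      ⟨some .count, none, store [] [] (i.reverse ++ t) k (a + i.length) 0⟩ (i.length + 1) := by
  induction i generalizing v t a with
  | nil => exact RunsIn.step (by simp [program, popCases])
  | cons x i ih =>
    refine RunsIn.head (y := ⟨some .readBody, some x, store i [] (x :: t) k (a + 1) 0⟩) ?_ ?_
    · simp [program, popCases, ← update_len (a := a) (m := a + 1), List.replicate_succ]
    · simpa [Nat.add_right_comm a, add_assoc] using ih (x :: t) (some x) (a + 1)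

theorem run_halve (t : List Letter) (v : Option Letter) (k a b : ℕ) :
    RunsIn (program c w) ⟨some .halve, v, store [] [] t k a b⟩
      ⟨some .restore, none, store [] [] t k 0 (b + a / 2)⟩ (a / 2 + 1) := by
  induction a using Nat.twoStepInduction generalizing v b with
  | zero => exact RunsIn.step (by simp [program, popCases])
  | one => exact RunsIn.step (by simp [program, popCases])
  | more a ih _ =>
    rw [show (a + 2) / 2 = a / 2 + 1 by omega]
    refine RunsIn.head (y := ⟨some .halve, some (some true), store [] [] t k a (b + 1)⟩) ?_ ?_
    · simp [program, popCases, List.replicate_succ, ← update_half (b := b) (m := b + 1)]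
    · convert ih (some (some true)) (b + 1) using 3
      omega

theorem run_restore (t : List Letter) (v : Option Letter) (k a b : ℕ) :
    RunsIn (program c w) ⟨some .restore, v, store [] [] t k a b⟩
      ⟨some .count, none, store [] [] t k (a + b) 0⟩ (b + 1) := by
  induction b generalizing v a with
  | zero => exact RunsIn.step (by simp [program, popCases])
  | succ b ih =>
    refine RunsIn.head (y := ⟨some .restore, some (some true), store [] [] t k (a + 1) b⟩) ?_ ?_
    · simp [program, popCases, List.replicate_succ, ← update_len (a := a) (m := a + 1)]
    · convert ih (some (some true)) (a + 1) using 3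
      omega

/-- Iterated rounded halving is division by `2 ^ k`. A round costs one step for the counter and at
most `a / 2 + 1` each for halving and restoring, hence at most `a + 3`. -/
theorem run_count (t : List Letter) (v : Option Letter) (k a : ℕ) :
    RunsIn (program c w) ⟨some .count, v, store [] [] t k a 0⟩
      ⟨some .test, none, store [] [] t 0 (a / 2 ^ k) 0⟩ (k * (a + 3) + 1) := by
  induction k generalizing v a with
  | zero =>
    have h : RunsIn (program c w) ⟨some .count, v, store [] [] t 0 a 0⟩
        ⟨some .test, none, store [] [] t 0 a 0⟩ 1 := RunsIn.step (by simp [program, popCases])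
    simpa using h
  | succ k ih =>
    have h₀ : RunsIn (program c w) ⟨some .count, v, store [] [] t (k + 1) a 0⟩
        ⟨some .halve, some (some true), store [] [] t k a 0⟩ 1 :=
      RunsIn.step (by simp [program, popCases, List.replicate_succ])
    have h := ((h₀.trans (run_halve t _ k a 0)).trans (run_restore t _ k 0 _)).trans (ih _ _)
    rw [zero_add, zero_add, Nat.div_div_eq_div_mul, ← pow_succ'] at h
    refine h.mono ?_
    have h1 : k * (a / 2 + 3) ≤ k * (a + 3) := Nat.mul_le_mul_left k (by omega)
    have h2 : (k + 1) * (a + 3) = k * (a + 3) + (a + 3) := by ring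
    omega

theorem run_emit (o t : List Letter) (v : Option Letter) :
    RunsIn (program c w) ⟨some .emit, v, store [] o t 0 0 0⟩
      ⟨none, none, store [] (t.reverse ++ o) [] 0 0 0⟩ (t.length + 1) := by
  induction t generalizing v o with
  | nil => exact RunsIn.step (by simp [program, popCases])
  | cons x t ih =>
    refine RunsIn.head (y := ⟨some .emit, some x, store [] (x :: o) t 0 0 0⟩) ?_ ?_
    · simp [program, popCases]
    · simpa using ih (x :: o) (some x)

theorem run_clearLen (t : List Letter) (v : Option Letter) (a : ℕ) :
    RunsIn (program c w) ⟨some .clearLen, v, store [] [] t 0 a 0⟩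
      ⟨some .clearCopy, none, store [] [] t 0 0 0⟩ (a + 1) := by
  induction a generalizing v with
  | zero => exact RunsIn.step (by simp [program, popCases])
  | succ a ih =>
    refine RunsIn.head (y := ⟨some .clearLen, some (some true), store [] [] t 0 a 0⟩) ?_ (ih _)
    simp [program, popCases, List.replicate_succ]

theorem run_clearCopy (t : List Letter) (v : Option Letter) :
    RunsIn (program c w) ⟨some .clearCopy, v, store [] [] t 0 0 0⟩
      ⟨none, none, store [] w.reverse [] 0 0 0⟩ (t.length + 1) := by
  induction t generalizing v with
  | nil => exact RunsIn.step (by simp [program, popCases, stepAux_pushWord])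
  | cons x t ih =>
    refine RunsIn.head (y := ⟨some .clearCopy, some x, store [] [] t 0 0 0⟩) ?_ (ih _)
    simp [program, popCases]

theorem run_test (t : List Letter) (v : Option Letter) (a : ℕ) :
    RunsIn (program c w) ⟨some .test, v, store [] [] t 0 a 0⟩
      ⟨none, none, store [] (if a = 0 then t.reverse else w.reverse) [] 0 0 0⟩
      (t.length + a + 3) := by
  cases a with
  | zero =>
    have h := RunsIn.head (x := ⟨some .test, v, store [] [] t 0 0 0⟩)
      (by simp [program, popCases]) (run_emit (c := c) (w := w) [] t none)
    rw [List.append_nil] at h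
    exact h.mono (by omega)
  | succ a =>
    rw [if_neg a.succ_ne_zero]
    refine RunsIn.mono (RunsIn.head (y := ⟨some .clearLen, some (some true),
      store [] [] t 0 a 0⟩) ?_ ((run_clearLen t _ a).trans (run_clearCopy t _))) (by omega)
    simp [program, popCases, List.replicate_succ]

theorem run_program (k : ℕ) (i : List Letter) :
    RunsIn (program c w)
      ⟨some .readParam, none, store (List.replicate k (some true) ++ none :: i) [] [] 0 0 0⟩
      ⟨none, none, store [] (if 2 ^ (k + c) ≤ i.length then w.reverse
        else List.replicate k (some true) ++ none :: i) [] 0 0 0⟩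
      ((k + c + 4) * (i.length + 3) + 2 * k) := by
  have h := (((run_readParam (c := c) (w := w) i [] none k 0).trans
    (run_readBody i _ _ _ _)).trans (run_count _ _ _ _)).trans (run_test _ _ _)
  have hdiv : i.length / 2 ^ (k + c) ≤ i.length := Nat.div_le_self _ _
  -- The quotient vanishes exactly below the threshold, so `2 ^ (k + c)` is never written out. The
  -- copy was stored reversed, and emitting it restores the order.
  have hif : (if i.length / 2 ^ (k + c) = 0 then
      (i.reverse ++ none :: (List.replicate k (some true) ++ [])).reverse else w.reverse) =
      (if 2 ^ (k + c) ≤ i.length then w.reverse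
        else List.replicate k (some true) ++ none :: i) := by
    by_cases hle : 2 ^ (k + c) ≤ i.length
    · rw [if_pos hle, if_neg (Nat.div_pos hle (by positivity)).ne']
    · rw [if_neg hle, if_pos (Nat.div_eq_of_lt (not_le.1 hle))]
      simp
  simp only [zero_add] at h
  rw [hif] at h
  refine h.mono ?_
  simp only [List.length_append, List.length_reverse, List.length_cons, List.length_replicate,
    List.length_nil]
  nlinarith

end Program

end Machine

/-! ### The kernelization and its size bound. -/

section Kernel

open Turing

/-- Turns the vertex bound into a threshold that halving can test. The constant 15 is least
possible: 14 fails at `k = 10`. -/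
theorem degree_bound_lt_two_pow (k : ℕ) :
    (k * (2 * k + 1) ^ 2) * (k * (2 * k + 1) ^ 2 + 1) < 2 ^ (k + 15) := by
  rcases lt_or_ge k 10 with h | h
  · interval_cases k <;> norm_num
  · induction k, h using Nat.le_induction with
    | base => norm_num
    | succ k h ih =>
      obtain ⟨j, rfl⟩ := Nat.exists_eq_add_of_le' h
      -- From 10 on, the left side at most doubles when `k` grows by 1; after the shift `k = j + 10`
      -- the slack has only positive coefficients.
      have hstep : (j + 10 + 1) * (2 * (j + 10 + 1) + 1) ^ 2 *
          ((j + 10 + 1) * (2 * (j + 10 + 1) + 1) ^ 2 + 1) +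
          (5038440 + 4663703 * j ^ 1 + 1511945 * j ^ 2 + 240236 * j ^ 3 + 20424 * j ^ 4 + 896 * j ^ 5 + 16 * j ^ 6) =
          2 * ((j + 10) * (2 * (j + 10) + 1) ^ 2 * ((j + 10) * (2 * (j + 10) + 1) ^ 2 + 1)) := by
        ring
      rw [show j + 10 + 1 + 15 = j + 10 + 15 + 1 by rfl, pow_succ _ (j + 10 + 15)]
      omega

namespace Instance

open Classical in
theorem two_le_degree (I : Instance) (v : Fin I.n) : 2 ≤ I.graph.degree v :=
  I.two_le_minDegree.trans (I.graph.minDegree_le_degree v)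

theorem pos (I : Instance) : 0 < I.n := by
  classical
  by_contra! h
  have h2 := I.two_le_minDegree
  have : IsEmpty (Fin I.n) := by rw [Nat.le_zero.1 h]; infer_instance
  rw [SimpleGraph.minDegree_of_subsingleton] at h2
  omega

theorem two_le_Δ (I : Instance) : 2 ≤ I.Δ := by
  classical
  exact (I.two_le_degree ⟨0, I.pos⟩).trans (I.graph.degree_le_maxDegree _)

theorem Δ_le (I : Instance) : I.Δ ≤ I.n := by
  classical
  exact SimpleGraph.maxDegree_le_of_forall_degree_le _ _ fun v =>
    ((I.graph.degree_lt_card_verts v).trans_eq (Fintype.card_fin _)).le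

theorem size_le (I : Instance) : I.size ≤ I.n * (I.n + 1) := by
  classical
  have h := I.graph.card_edgeFinset_le_card_choose_two
  rw [Fintype.card_fin, Nat.choose_two_right] at h
  have h1 : I.n * (I.n - 1) / 2 ≤ I.n * I.n :=
    (Nat.div_le_self _ _).trans (Nat.mul_le_mul_left _ (Nat.sub_le _ _))
  rw [size, mul_add, mul_one]
  convert Nat.add_le_add_left (h.trans h1) I.n using 1
  ring

/-- The rows of the adjacency matrix of an instance, as they occur in its encoding. -/
noncomputable def matrixWord (I : Instance) : List (Option Bool) :=
  I.encode.drop (I.k + 1)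

theorem encode_eq (I : Instance) :
    I.encode = List.replicate I.k (some true) ++ none :: I.matrixWord := by
  rw [matrixWord, encode, List.drop_append]
  simp

/-- Each row carries a separator. This is the number the machine measures, and it also bounds the
size of the graph, whence the form of the threshold. -/
theorem length_matrixWord (I : Instance) : I.matrixWord.length = I.n * (I.n + 1) := by
  simp [matrixWord, encode, List.drop_append, List.length_flatMap]

/-- An instance with a large vertex number is a yes-instance. -/
theorem isYes_of_two_pow_le (I : Instance) (h : 2 ^ (I.k + 15) ≤ I.n * (I.n + 1)) : I.IsYes := by
  classical
  by_contra hno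
  have hn := card_le_of_forall_card_lt (G := I.graph) I.two_le_degree (k := I.k)
    fun S hS => by
      by_contra! hc
      exact hno ⟨S, by convert hS, hc⟩
  rw [Fintype.card_fin] at hn
  have := degree_bound_lt_two_pow I.k
  have := Nat.mul_le_mul hn (Nat.add_le_add_right hn 1)
  omega

/-- The triangle with solution size `0`. -/
def triangle : Instance where
  n := 3
  graph := ⊤
  k := 0
  two_le_minDegree := by
    have h : 2 ≤ (⊤ : SimpleGraph (Fin 3)).minDegree := by
      rw [SimpleGraph.minDegree_top]
      simp
    convert h

theorem isYes_triangle : triangle.IsYes := by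
  classical
  have : Nonempty (Fin triangle.n) := ⟨⟨0, triangle.pos⟩⟩
  obtain ⟨S, -, hS⟩ :=
    (isDefensiveAlliance_univ (G := triangle.graph)).exists_isLocallyMinimal
  exact ⟨S, by convert hS, Nat.zero_le _⟩

/-- The kernelization: replaces instances with many vertices by a trivial yes-instance. -/
def kernel (I : Instance) : Instance :=
  if 2 ^ (I.k + 15) ≤ I.n * (I.n + 1) then triangle else I

end Instance

open Instance

theorem initList_machine (c : ℕ) (w i : List Letter) :
    initList (machine c w) i = (⟨some .readParam, none, store i [] [] 0 0 0⟩ : Config) := by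
  refine congrArg (TM2.Cfg.mk (some Label.readParam) none) (funext fun s => ?_)
  cases s <;> rfl

theorem haltList_machine (c : ℕ) (w o : List Letter) :
    haltList (machine c w) o = (⟨none, none, store [] o [] 0 0 0⟩ : Config) := by
  refine congrArg (TM2.Cfg.mk none none) (funext fun s => ?_)
  cases s <;> rfl

theorem run_kernel (I : Instance) :
    RunsIn (program 15 triangle.encode.reverse)
      ⟨some .readParam, none, store I.encode [] [] 0 0 0⟩
      ⟨none, none, store [] I.kernel.encode [] 0 0 0⟩
      ((I.encode.length + 18) * (I.encode.length + 2) + 2 * I.encode.length) := by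
  have h := run_program (c := 15) (w := triangle.encode.reverse) I.k I.matrixWord
  have hk : (if 2 ^ (I.k + 15) ≤ I.matrixWord.length then triangle.encode.reverse.reverse
      else List.replicate I.k (some true) ++ none :: I.matrixWord) = I.kernel.encode := by
    rw [length_matrixWord, ← encode_eq, List.reverse_reverse, kernel]
    split_ifs <;> rfl
  rw [hk, ← encode_eq] at h
  refine h.mono ?_
  have hl : I.encode.length = I.k + (I.matrixWord.length + 1) := by
    conv_lhs => rw [encode_eq]
    simp
  refine Nat.add_le_add (Nat.mul_le_mul ?_ ?_) ?_ <;> omega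

theorem nonempty_outputsInTime_machine {c n : ℕ} {w i o : List Letter}
    (h : RunsIn (program c w) ⟨some .readParam, none, store i [] [] 0 0 0⟩
      ⟨none, none, store [] o [] 0 0 0⟩ n) :
    Nonempty (TM2OutputsInTime (machine c w)
      (i.map (Equiv.refl ((machine c w).Γ (machine c w).k₀)).invFun)
      (some (o.map (Equiv.refl ((machine c w).Γ (machine c w).k₁)).invFun)) n) := by
  have hmap : ∀ i' o' : List Letter, i' = i → o' = o →
      Nonempty (TM2OutputsInTime (machine c w) i' (some o') n) := by
    rintro _ _ rfl rfl
    rw [← initList_machine c w, ← haltList_machine c w] at h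
    exact h
  exact hmap _ _ (List.map_id i) (List.map_id o)

/-- The kernelization is computable in polynomial time. -/
noncomputable def kernelComputableInPolyTime :
    TM2ComputableInPolyTime Instance.encode Instance.encode kernel where
  tm := machine 15 triangle.encode.reverse
  inputAlphabet := Equiv.refl _
  outputAlphabet := Equiv.refl _
  time := (Polynomial.X + 18) * (Polynomial.X + 2) + 2 * Polynomial.X
  outputsFun I := by
    have heval : ((Polynomial.X + 18) * (Polynomial.X + 2) + 2 * Polynomial.X :
        Polynomial ℕ).eval I.encode.length =
        (I.encode.length + 18) * (I.encode.length + 2) + 2 * I.encode.length := by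
      simp
    rw [heval]
    exact (nonempty_outputsInTime_machine (run_kernel I)).some

theorem isKernelization_kernel :
    IsKernelization kernel (fun k Δ => 2 ^ 15 * Δ ^ (k ^ 2 + 2 * k)) := by
  refine ⟨⟨kernelComputableInPolyTime⟩, fun I => ?_⟩
  -- The degree enters only through `Δ ≥ 2`: the threshold itself already bounds the kernel.
  have hle : 2 ^ (I.k + 15) ≤ 2 ^ 15 * I.Δ ^ (I.k ^ 2 + 2 * I.k) := by
    rw [Nat.add_comm, pow_add]
    refine Nat.mul_le_mul_left _ ?_
    calc 2 ^ I.k ≤ 2 ^ (I.k ^ 2 + 2 * I.k) := Nat.pow_le_pow_right two_pos (by nlinarith)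
      _ ≤ I.Δ ^ (I.k ^ 2 + 2 * I.k) := Nat.pow_le_pow_left I.two_le_Δ _
  by_cases h : 2 ^ (I.k + 15) ≤ I.n * (I.n + 1)
  · have hs := triangle.size_le
    have hΔ := triangle.Δ_le
    have h15 : 2 ^ 15 ≤ 2 ^ (I.k + 15) := Nat.pow_le_pow_right two_pos (by omega)
    have hn : triangle.n = 3 := rfl
    have hk : triangle.k = 0 := rfl
    rw [hn] at hs hΔ
    rw [kernel, if_pos h]
    exact ⟨⟨fun _ => I.isYes_of_two_pow_le h, fun _ => isYes_triangle⟩,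
      by dsimp only; omega, by dsimp only; omega, by dsimp only; omega⟩
  · have hs := I.size_le
    have hΔ := I.Δ_le
    have hn : I.n ≤ I.n * (I.n + 1) := Nat.le_mul_of_pos_right _ (Nat.succ_pos _)
    have hk : I.k < 2 ^ (I.k + 15) :=
      Nat.lt_two_pow_self.trans_le (Nat.pow_le_pow_right two_pos (by omega))
    rw [kernel, if_neg h]
    exact ⟨Iff.rfl, by dsimp only; omega, by dsimp only; omega, by dsimp only; omega⟩

end Kernel

end LocMinAlliance

theorem theorem4p2 :
    (∃ (C : ℕ) (f : LocMinAlliance.Instance → LocMinAlliance.Instance),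
      LocMinAlliance.IsKernelization f (fun k Δ => C * Δ ^ (k ^ 2 + 2 * k))) ∧
    (∀ (V : Type*) [Fintype V] [DecidableEq V] (G : SimpleGraph V) [DecidableRel G.Adj] (k : ℕ),
      0 < k → G.Connected → 2 ≤ G.minDegree → 2 * (k ^ 2 + 2 * k) ≤ G.diam →
        ∃ D : Finset V,
          LocMinAlliance.IsLocallyMinimalDefensiveAlliance G D ∧ k ≤ D.card) :=
  ⟨⟨2 ^ 15, LocMinAlliance.Instance.kernel, LocMinAlliance.isKernelization_kernel⟩,
    fun _ _ _ G _ _ hk hc hG hd => LocMinAlliance.exists_isLocallyMinimal_of_le_diam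
      (fun v => hG.trans (G.minDegree_le_degree v)) hc hk hd⟩
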